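/- Let $\mathbf A$ be an algebra (a set $A$ with a family of finitary basic operations) which is idempotent, i.e. every basic operation $f$ satisfies $f(a,a,\ldots,a)=a$ for all $a\in A$, and let $X\subseteq A$. A system of equations $\mathcal S$, whose terms are built from variables and from operation symbols of some signature, is said to be satisfied by $\mathbf A$ \emph{locally on} $X$ if one can assign to each symbol of that signature a term operation of $\mathbf A$ of the same arity so that every equation of $\mathcal S$ holds whenever its variables take values in $X$. A \emph{Taylor system of equations} is a system in one $n$-ary symbol $t$ (for some $n$) consisting of $t(x,x,\ldots,x)\approx x$ together with $n$ equations, one for each position $i\in\{0,\ldots,n-1\}$, of the form $$t(p_{i,0},\ldots,p_{i,n-1})\approx t(q_{i,0},\ldots,q_{i,n-1}),\qquad p_{i,j},\,q_{i,j}\in\{x,y\},\quad p_{i,i}=x,\quad q_{i,i}=y .$$ If $\mathbf A$ satisfies some Taylor system of equations locally on $X$, then $\mathbf A$ satisfies the double loop equations locally on $X$; that is, there is a $12$-ary term operation $d$ of $\mathbf A$ such that for all $x,y\in X$ \begin{align*} d(x,x,\;x,x,x,x,\;y,y,y,y,\;y,y) &= d(x,x,\;y,y,y,y,\;x,x,x,x,\;y,y),\\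 d(x,y,\;x,x,y,y,\;x,x,y,y,\;x,y) &= d(y,x,\;x,y,x,y,\;x,y,x,y,\;y,x). \end{align*} -/

import Mathlib

open FirstOrder

namespace LocalDoubleLoop

/-! An algebra in a signature `L` is an `L`-structure, where `L` is a first-order language without
relation symbols (`L.IsAlgebraic`).  Terms over `L` in a set of variables `V` are `L.Term V`. -/

/-- An algebra is idempotent if each of its basic operations `f` satisfies
`f (a, a, …, a) = a` for every element `a`. -/
def IsIdempotentAlgebra (L : Language) (A : Type*) [L.Structure A] : Prop :=
  ∀ (n : ℕ) (f : L.Functions n) (a : A), Language.Structure.funMap f (fun _ => a) = a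

/-- A system of equations in the signature `D` with variables from `V`: a set of pairs of
`D`-terms, the pair `(s, t)` standing for the equation `s ≈ t`. -/
abbrev EquationalCondition (D : Language) (V : Type*) : Type _ :=
  Set (D.Term V × D.Term V)

/-- The algebra `A` satisfies the equational condition `S` locally on `X`: one can assign to every
symbol of the signature of `S` a term of `A` (in as many variables as the arity of the symbol) such
that, after replacing the symbols by the assigned terms, every equation of `S` holds in `A`
whenever the variables take values in `X`. -/
def SatisfiesLocallyOn (L : Language) {A : Type*} [L.Structure A] {D : Language} {V : Type*}
    (S : EquationalCondition D V) (X : Set A) : Prop :=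
  ∃ assign : ∀ {n : ℕ}, D.Functions n → L.Term (Fin n),
    ∀ e ∈ S, ∀ v : V → A, (∀ i, v i ∈ X) →
      (e.1.substFunc assign).realize v = (e.2.substFunc assign).realize v

/-- The two variables occurring in the equations. -/
inductive Var2 : Type
  | x
  | y

/-- A single symbol, of arity `n`. -/
inductive SingleSymbol (n : ℕ) : ℕ → Type
  | symb : SingleSymbol n n

/-- The signature consisting of a single `n`-ary operation symbol. -/
def singleSignature (n : ℕ) : Language :=
  ⟨SingleSymbol n, fun _ => Empty⟩

/-- The term `t (w 0, …, w (n - 1))`, where `t` is the single `n`-ary symbol and every `w j` is one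
of the variables `x`, `y`. -/
def symbolApplied {n : ℕ} (w : Fin n → Var2) : (singleSignature n).Term Var2 :=
  Language.Term.func (L := singleSignature n) SingleSymbol.symb (fun j => Language.Term.var (w j))

/-- `S` is a Taylor system of equations of arity `n`: it consists of `n` equations
`t (p i 0, …, p i (n - 1)) ≈ t (q i 0, …, q i (n - 1))`, one for each position `i`, with the
variable `x` on the left and `y` on the right at the position `i` and with arbitrary choices among
`x`, `y` at the other positions, and of the equation `t (x, x, …, x) ≈ x`. -/
def IsTaylorSystem {n : ℕ} (S : EquationalCondition (singleSignature n) Var2) : Prop :=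
  ∃ p q : Fin n → Fin n → Var2,
    (∀ i, p i i = Var2.x ∧ q i i = Var2.y) ∧
    S = Set.range (fun i => (symbolApplied (p i), symbolApplied (q i))) ∪
      {(symbolApplied (fun _ => Var2.x), Language.Term.var Var2.x)}

open Var2 in
/-- The double loop equations, for a single symbol `d` of arity 12:
`d (xx, xxxx, yyyy, yy) ≈ d (xx, yyyy, xxxx, yy)` and
`d (xy, xxyy, xxyy, xy) ≈ d (yx, xyxy, xyxy, yx)`. -/
def doubleLoopEquations : EquationalCondition (singleSignature 12) Var2 :=
  {(symbolApplied ![x, x,  x, x, x, x,  y, y, y, y,  y, y],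
    symbolApplied ![x, x,  y, y, y, y,  x, x, x, x,  y, y]),
   (symbolApplied ![x, y,  x, x, y, y,  x, x, y, y,  x, y],
    symbolApplied ![y, x,  x, y, x, y,  x, y, x, y,  y, x])}

end LocalDoubleLoop

namespace LocalDoubleLoop

/-! ### Shifting letter sequences and iterating an operation along a tree -/

section Tree

variable {n : ℕ} {B : Type*}

/-! Let `t` be the Taylor term. The term `d` is a deep complete tree of copies of `t` whose leaves,
indexed by words over `Fin n`, carry the 12 variables. The 12 columns of the double loop equations
are exactly the ordered pairs of distinct elements of {x,y}², so it suffices to find labels with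
`label K c p a ≠ label K c q (shift a)`. The two equations then compare these two labellings in the
first and in the second coordinate. By idempotence, shifting a labelling does not change the value
of its tree, so only `label K c p` and `label K c q` remain to be compared. Their second coordinates
coincide. Their first coordinates differ only at words i^K j, where they are `p i j` and `q i j`,
and the i-th Taylor equation makes the subtrees at i^K equal (`tree_label_fst`). Distinctness would
be a 4-colouring of the shift graph, obstructed only by constant words, which the shift fixes; there
`p i i = x` and `q i i = y` help. Elsewhere words are coloured by run length and first letter, and
colours are eliminated one at a time down to four (`IsShiftColouring.pick`). -/

/-- Prepend a letter to a sequence. -/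
def consSeq (i : Fin n) (a : ℕ → Fin n) : ℕ → Fin n
  | 0 => i
  | s + 1 => a s

/-- Delete the first letter of a sequence. -/
def shift (a : ℕ → Fin n) : ℕ → Fin n := fun s => a (s + 1)

@[simp] lemma shift_consSeq (i : Fin n) (a : ℕ → Fin n) : shift (consSeq i a) = a := rfl

/-- Prepend a list of letters to a sequence. -/
def prefixSeq (u : List (Fin n)) (a : ℕ → Fin n) : ℕ → Fin n := u.foldr consSeq a

lemma prefixSeq_length_add (u : List (Fin n)) (a : ℕ → Fin n) (s : ℕ) :
    prefixSeq u a (u.length + s) = a s := by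
  induction u with
  | nil => simp [prefixSeq]
  | cons i u ih =>
    have : (i :: u).length + s = (u.length + s) + 1 := by simp; omega
    rw [this]
    exact ih

lemma prefixSeq_eq_of_lt (u : List (Fin n)) (a b : ℕ → Fin n) {s : ℕ} (hs : s < u.length) :
    prefixSeq u a s = prefixSeq u b s := by
  induction u generalizing s with
  | nil => simp at hs
  | cons i u ih =>
    cases s with
    | zero => rfl
    | succ s => exact ih (by simpa using hs)

/-- A function of sequences depends on the first `k` letters only. -/
def DependsOnFirst (k : ℕ) (f : (ℕ → Fin n) → B) : Prop :=
  ∀ a b : ℕ → Fin n, (∀ s < k, a s = b s) → f a = f b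

/-- The value of the complete tree of depth `k` of applications of `op`, in which the leaf reached
along a word `w` carries `f w`; the word is continued by the sequence `z`. -/
def tree (op : (Fin n → B) → B) (z : ℕ → Fin n) : ℕ → ((ℕ → Fin n) → B) → B
  | 0, f => f z
  | k + 1, f => op fun i => tree op z k fun a => f (consSeq i a)

variable {op : (Fin n → B) → B} {z : ℕ → Fin n}

lemma tree_const (hop : ∀ b, op (fun _ => b) = b) (k : ℕ) (b : B) :
    tree op z k (fun _ => b) = b := by
  induction k with
  | zero => rfl
  | succ k ih => simp [tree, ih, hop]

/-- The subtrees below the root are all equal, so idempotence collapses the root. -/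
lemma tree_succ_shift (hop : ∀ b, op (fun _ => b) = b) (k : ℕ) (f : (ℕ → Fin n) → B) :
    tree op z (k + 1) (fun a => f (shift a)) = tree op z k f := by
  simp [tree, hop]

/-- Here it is the bottom level that is constant and collapses. -/
lemma tree_succ_of_dependsOnFirst (hop : ∀ b, op (fun _ => b) = b) (k : ℕ)
    (f : (ℕ → Fin n) → B) (hf : DependsOnFirst k f) :
    tree op z (k + 1) f = tree op z k f := by
  induction k generalizing f with
  | zero =>
    have : ∀ a b, f a = f b := fun a b => hf a b (by simp)
    simp only [tree]
    rw [← hop (f z)]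
    exact congrArg op (funext fun i => this _ _)
  | succ k ih =>
    rw [tree, tree]
    refine congrArg op (funext fun i => ih _ fun a b hab => hf _ _ fun s hs => ?_)
    cases s with
    | zero => rfl
    | succ s => exact hab s (by omega)

lemma tree_congr_prefix (m K : ℕ) (f g : (ℕ → Fin n) → B)
    (h : ∀ u : List (Fin n), u.length = K →
      tree op z m (fun a => f (prefixSeq u a)) = tree op z m (fun a => g (prefixSeq u a))) :
    tree op z (m + K) f = tree op z (m + K) g := by
  induction K generalizing f g with
  | zero => exact h [] rfl
  | succ K ih =>
    rw [← Nat.add_assoc, tree, tree]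
    exact congrArg op (funext fun i => ih _ _ fun u hu => h (i :: u) (by simp [hu]))

lemma tree_succ_head (hop : ∀ b, op (fun _ => b) = b) (m : ℕ) (w : Fin n → B) :
    tree op z (m + 1) (fun a => w (a 0)) = op w := by
  simp [tree, consSeq, tree_const hop]

end Tree

/-! ### The length of the initial run of a sequence -/

section Run

variable {n : ℕ}

/-- The length of the initial run of equal letters of a sequence, cut off at `K`. -/
def runLen (K : ℕ) (a : ℕ → Fin n) : ℕ :=
  Nat.find (⟨K, Or.inl rfl⟩ : ∃ d, d = K ∨ a d ≠ a 0)

lemma runLen_le (K : ℕ) (a : ℕ → Fin n) : runLen K a ≤ K :=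
  Nat.find_min' _ (Or.inl rfl)

lemma eq_of_lt_runLen {K : ℕ} {a : ℕ → Fin n} {r : ℕ} (hr : r < runLen K a) : a r = a 0 := by
  have := Nat.find_min _ hr
  push Not at this
  exact this.2

lemma ne_of_runLen_lt {K : ℕ} {a : ℕ → Fin n} (h : runLen K a < K) : a (runLen K a) ≠ a 0 := by
  rcases Nat.find_spec (⟨K, Or.inl rfl⟩ : ∃ d, d = K ∨ a d ≠ a 0) with h' | h'
  · exact absurd h' h.ne
  · exact h'

lemma runLen_eq {K d : ℕ} {a : ℕ → Fin n} (hd : d < K) (h : ∀ r < d, a r = a 0)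
    (hne : a d ≠ a 0) : runLen K a = d := by
  apply le_antisymm (Nat.find_min' _ (Or.inr hne))
  by_contra hlt
  push Not at hlt
  exact ne_of_runLen_lt (hlt.trans hd) (h _ hlt)

lemma runLen_eq_self {K : ℕ} {a : ℕ → Fin n} (h : ∀ r < K, a r = a 0) : runLen K a = K := by
  apply le_antisymm (runLen_le K a)
  by_contra hlt
  push Not at hlt
  exact ne_of_runLen_lt hlt (h _ hlt)

lemma runLen_pos {K : ℕ} (hK : 0 < K) (a : ℕ → Fin n) : 0 < runLen K a := by
  by_contra h
  have h0 : runLen K a = 0 := by omega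
  exact ne_of_runLen_lt (h0 ▸ hK) (by rw [h0])

lemma dependsOnFirst_runLen {K : ℕ} (hK : 0 < K) :
    DependsOnFirst K (runLen K : (ℕ → Fin n) → ℕ) := by
  intro a b hab
  rcases (runLen_le K a).lt_or_eq with h | h
  · refine (runLen_eq h (fun r hr => ?_) ?_).symm
    · rw [← hab r (hr.trans h), ← hab 0 hK]
      exact eq_of_lt_runLen hr
    · rw [← hab _ h, ← hab 0 hK]
      exact ne_of_runLen_lt h
  · rw [h]
    refine (runLen_eq_self fun r hr => ?_).symm
    rw [← hab r hr, ← hab 0 hK]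
    exact eq_of_lt_runLen (h ▸ hr)

lemma runLen_shift {K : ℕ} {a : ℕ → Fin n} (h2 : 2 ≤ runLen K a) (hK : runLen K a < K) :
    runLen K (shift a) = runLen K a - 1 := by
  have h1 : a 1 = a 0 := eq_of_lt_runLen (K := K) (by omega)
  apply runLen_eq (by omega)
  · intro r hr
    change a (r + 1) = a 1
    rw [h1]
    exact eq_of_lt_runLen (K := K) (by omega)
  · change a (runLen K a - 1 + 1) ≠ a 1
    rw [h1, Nat.sub_add_cancel (by omega)]
    exact ne_of_runLen_lt hK

lemma runLen_shift_of_eq {K : ℕ} (hK : 2 ≤ K) {a : ℕ → Fin n} (h : runLen K a = K)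
    (ha : a K = a 0) : runLen K (shift a) = K := by
  have h1 : a 1 = a 0 := eq_of_lt_runLen (K := K) (by omega)
  refine runLen_eq_self fun r hr => ?_
  change a (r + 1) = a 1
  rw [h1]
  rcases Nat.lt_or_ge (r + 1) K with h' | h'
  · exact eq_of_lt_runLen (h ▸ h')
  · rw [show r + 1 = K by omega, ha]

lemma runLen_shift_of_ne {K : ℕ} (hK : 2 ≤ K) {a : ℕ → Fin n} (h : runLen K a = K)
    (ha : a K ≠ a 0) : runLen K (shift a) = K - 1 := by
  have h1 : a 1 = a 0 := eq_of_lt_runLen (K := K) (by omega)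
  apply runLen_eq (by omega)
  · intro r hr
    change a (r + 1) = a 1
    rw [h1]
    exact eq_of_lt_runLen (K := K) (by omega)
  · change a (K - 1 + 1) ≠ a 1
    rwa [h1, Nat.sub_add_cancel (by omega)]

lemma head_ne_of_runLen_eq_one {K : ℕ} (hK : 2 ≤ K) {a : ℕ → Fin n} (h : runLen K a = 1) :
    shift a 0 ≠ a 0 := by
  have := ne_of_runLen_lt (K := K) (a := a) (by omega)
  rwa [h] at this

end Run

/-! ### Colouring sequences so that consecutive shifts get different colours -/

section Colouring

/-- The first element of the two-element set attached to the colour `A`. -/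
def pickFst (N A : ℕ) : ℕ := if A = N then 0 else A

/-- The second element of the set attached to the colour `A` (equal to the first one for the
colours other than `0, 1, 2, 3, N`). -/
def pickSnd (N A : ℕ) : ℕ :=
  if A = 0 then 2 else if A = 1 then 2 else if A = 2 then 3 else if A = 3 then 0
    else if A = N then 1 else A

/-- An element of the set attached to `A` which, if `A ≠ B`, is not in the set attached to `B`. -/
def pick (N A B : ℕ) : ℕ :=
  if A = B ∨ (pickFst N A ≠ pickFst N B ∧ pickFst N A ≠ pickSnd N B) then pickFst N A
    else pickSnd N A

lemma pick_eq (N A B : ℕ) : pick N A B = pickFst N A ∨ pick N A B = pickSnd N A := by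
  unfold pick
  split_ifs <;> simp

lemma pick_lt {N A : ℕ} (hN : 4 ≤ N) (hA : A ≤ N) (B : ℕ) : pick N A B < N := by
  have h1 : pickFst N A < N := by unfold pickFst; split_ifs <;> omega
  have h2 : pickSnd N A < N := by unfold pickSnd; split_ifs <;> omega
  rcases pick_eq N A B with h | h <;> omega

/-- The attached sets {0,2}, {1,2}, {2,3}, {3,0}, {0,1} (for 0, 1, 2, 3, `N`) and the singletons of
the other colours form an antichain. -/
lemma pick_ne {N A B : ℕ} (hN : 4 ≤ N) (hAB : A ≠ B) :
    pick N A B ≠ pickFst N B ∧ pick N A B ≠ pickSnd N B := by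
  unfold pick
  by_cases h : pickFst N A ≠ pickFst N B ∧ pickFst N A ≠ pickSnd N B
  · simp [h]
  · rw [if_neg (by tauto)]
    revert h
    unfold pickFst pickSnd
    split_ifs <;> omega

lemma pick_ne_pick {N A B : ℕ} (hN : 4 ≤ N) (hAB : A ≠ B) (C : ℕ) :
    pick N A B ≠ pick N B C := by
  obtain ⟨h1, h2⟩ := pick_ne hN hAB
  rcases pick_eq N B C with h | h <;> rw [h] <;> assumption

lemma pick_zero_zero {N : ℕ} : pick N 0 0 = 0 := by
  unfold pick pickFst
  split_ifs <;> first | rfl | simp_all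

lemma pick_zero_one {N : ℕ} (hN : 4 ≤ N) : pick N 0 1 = 0 := by
  unfold pick pickFst pickSnd
  split_ifs <;> omega

lemma pick_one_zero {N : ℕ} (hN : 4 ≤ N) : pick N 1 0 = 1 := by
  unfold pick pickFst pickSnd
  split_ifs <;> omega

variable {n : ℕ}

/-- A colouring by `N` colours under which a sequence and its shift get different colours unless
the sequence starts with `K` equal letters, and which is prescribed on the sequences that are nearly
constant at the beginning. -/
structure IsShiftColouring (K N s : ℕ) (c : (ℕ → Fin n) → ℕ) : Prop where
  lt : ∀ a, c a < N
  ne_shift : ∀ a, runLen K a < K → c a ≠ c (shift a)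
  eq_zero : ∀ a, runLen K a = K → c a = 0
  eq_one : ∀ a, runLen K a = 1 → runLen K (shift a) = K → c a = 1
  eq_mod : ∀ a, s ≤ runLen K a → runLen K a < K → c a = runLen K a % 2
  dependsOnFirst : ∃ M, DependsOnFirst M c

lemma DependsOnFirst.mono {B : Type*} {f : (ℕ → Fin n) → B} {k m : ℕ} (h : DependsOnFirst k f)
    (hkm : k ≤ m) : DependsOnFirst m f :=
  fun a b hab => h a b fun s hs => hab s (hs.trans_le hkm)

lemma DependsOnFirst.shift {B : Type*} {f : (ℕ → Fin n) → B} {k : ℕ} (h : DependsOnFirst k f) :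
    DependsOnFirst (k + 1) fun a => f (shift a) :=
  fun _ _ hab => h _ _ fun s hs => hab (s + 1) (by omega)

/-- `pick` preserves the colours 0 and 1 alternating along a run. The colour now also looks at the
shift, whose run is one shorter, so the threshold `s` grows by one. -/
lemma IsShiftColouring.pick {K N s : ℕ} {c : (ℕ → Fin n) → ℕ} (hc : IsShiftColouring K (N + 1) s c)
    (hN : 4 ≤ N) (hK : 2 ≤ K) (hK2 : K % 2 = 0) (hs : 2 ≤ s) (hsK : s < K) :
    IsShiftColouring K N (s + 1) fun a => LocalDoubleLoop.pick N (c a) (c (shift a)) where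
  lt a := pick_lt hN (Nat.lt_succ_iff.mp (hc.lt a)) _
  ne_shift a ha := pick_ne_pick hN (hc.ne_shift a ha) _
  eq_zero a ha := by
    have : c (shift a) = 0 ∨ c (shift a) = 1 := by
      by_cases h : a K = a 0
      · exact Or.inl (hc.eq_zero _ (runLen_shift_of_eq hK ha h))
      · have h' := runLen_shift_of_ne hK ha h
        right
        -- `K` is even, so run length `K - 1` has colour 1.
        rw [hc.eq_mod _ (by omega) (by omega), h']
        omega
    rcases this with h | h <;> rw [hc.eq_zero a ha, h]
    · exact pick_zero_zero
    · exact pick_zero_one hN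
  eq_one a ha hsa := by
    rw [hc.eq_one a ha hsa, hc.eq_zero _ hsa]
    exact pick_one_zero hN
  eq_mod a ha haK := by
    have h' := runLen_shift (by omega) haK
    rw [hc.eq_mod a (by omega) haK, hc.eq_mod _ (by omega) (by omega), h']
    rcases Nat.mod_two_eq_zero_or_one (runLen K a) with h | h
    · rw [h, show (runLen K a - 1) % 2 = 1 by omega]
      exact pick_zero_one hN
    · rw [h, show (runLen K a - 1) % 2 = 0 by omega]
      exact pick_one_zero hN
  dependsOnFirst := by
    obtain ⟨M, hM⟩ := hc.dependsOnFirst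
    refine ⟨M + 1, fun a b hab => ?_⟩
    have h1 := hM.mono (Nat.le_succ M) a b hab
    have h2 := hM.shift a b hab
    simp only at h2
    simp only [h1, h2]

/-- A colouring of sequences by the length of the initial run and the first letter. -/
def baseColour (K : ℕ) (a : ℕ → Fin n) : ℕ :=
  if runLen K a = 1 then (if runLen K (shift a) = K then 1 else (a 0 : ℕ) + 2)
  else runLen K a % 2

/-- Parity alternates while a run shrinks. After a run of length one the first letter changes, and
letter colours are at least 2, away from the parities. -/
lemma isShiftColouring_baseColour {K : ℕ} (hK : 2 ≤ K) (hK2 : K % 2 = 0) :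
    IsShiftColouring K (n + 2) 2 (baseColour K : (ℕ → Fin n) → ℕ) where
  lt a := by
    have := (a 0).isLt
    unfold baseColour
    split_ifs <;> omega
  ne_shift a ha := by
    have hpos := runLen_pos (by omega : 0 < K) a
    have hne : runLen K a = 1 → ((shift a 0 : Fin n) : ℕ) ≠ a 0 := fun h h' =>
      head_ne_of_runLen_eq_one hK h (Fin.ext h')
    have hsh : 2 ≤ runLen K a → runLen K (shift a) = runLen K a - 1 := fun h => runLen_shift h ha
    unfold baseColour
    by_cases h1 : runLen K a = 1
    · have := hne h1
      split_ifs <;> omega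
    · have := hsh (by omega)
      split_ifs <;> omega
  eq_zero a ha := by
    unfold baseColour
    split_ifs <;> omega
  eq_one a ha hsa := by simp [baseColour, ha, hsa]
  eq_mod a ha _ := by simp [baseColour, show runLen K a ≠ 1 by omega]
  dependsOnFirst := by
    refine ⟨K + 1, fun a b hab => ?_⟩
    have h := dependsOnFirst_runLen (n := n) (by omega : 0 < K)
    have h1 := h.mono (Nat.le_succ K) a b hab
    have h2 := h.shift a b hab
    simp only at h2
    simp only [baseColour, h1, h2, hab 0 (by omega)]

lemma exists_isShiftColouring_four {K : ℕ} (hK : 2 ≤ K) (hK2 : K % 2 = 0) (m s : ℕ) (hs : 2 ≤ s)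
    (hsK : s + m < K) (c : (ℕ → Fin n) → ℕ) (hc : IsShiftColouring K (4 + m) s c) :
    ∃ c' : (ℕ → Fin n) → ℕ, IsShiftColouring K 4 (s + m) c' := by
  induction m generalizing s c with
  | zero => exact ⟨c, hc⟩
  | succ m ih =>
    obtain ⟨c', hc'⟩ := ih (s + 1) (by omega) (by omega) _
      (hc.pick (N := 4 + m) (by omega) hK hK2 hs (by omega))
    exact ⟨c', by rwa [show s + (m + 1) = s + 1 + m by omega]⟩

/-- The four colours as pairs of variables. -/
def colourPair (c : ℕ) : Var2 × Var2 :=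
  if c = 0 then (Var2.y, Var2.y) else if c = 1 then (Var2.x, Var2.y)
  else if c = 2 then (Var2.x, Var2.x) else (Var2.y, Var2.x)

lemma colourPair_ne {c c' : ℕ} (hc : c < 4) (hc' : c' < 4) (h : c ≠ c') :
    colourPair c ≠ colourPair c' := by
  interval_cases c <;> interval_cases c' <;> simp_all [colourPair]

/-- The labelling by pairs of variables: on a sequence starting with `K` letters `i` and the letter
`j` it is given by `p i j`, and by `c` on the other sequences. -/
def label (K : ℕ) (c : (ℕ → Fin n) → ℕ) (p : Fin n → Fin n → Var2) (a : ℕ → Fin n) :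
    Var2 × Var2 :=
  if runLen K a = K then (p (a 0) (a K), if a K = a 0 then Var2.y else Var2.x)
  else colourPair (c a)

lemma label_ne_label_shift {K s : ℕ} {c : (ℕ → Fin n) → ℕ} (hc : IsShiftColouring K 4 s c)
    (hK : 2 ≤ K) (hK2 : K % 2 = 0) (hsK : s < K) {p q : Fin n → Fin n → Var2}
    (hpq : ∀ i, p i i = Var2.x ∧ q i i = Var2.y) (a : ℕ → Fin n) :
    label K c p a ≠ label K c q (shift a) := by
  -- Second coordinate y forces `b K = b 0`, and then the first one is `q i i = y`.
  have key : ∀ b : ℕ → Fin n, runLen K b = K → label K c q b ≠ (Var2.x, Var2.y) := by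
    intro b hb
    by_cases h : b K = b 0 <;> simp [label, hb, h, (hpq (b 0)).2]
  by_cases ha : runLen K a = K
  · by_cases h : a K = a 0
    · have hl : label K c p a = (Var2.x, Var2.y) := by simp [label, ha, h, (hpq (a 0)).1]
      rw [hl]
      exact (key _ (runLen_shift_of_eq hK ha h)).symm
    · have h' := runLen_shift_of_ne hK ha h
      -- Second coordinates differ: x at `a`, and y in the pair (x, y) of colour 1.
      have h1 : c (shift a) = 1 := by
        rw [hc.eq_mod _ (by omega) (by omega), h']
        omega
      have : K - 1 ≠ K := by omega
      simp [label, ha, h, h', h1, colourPair, this]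
  · have haK : runLen K a < K := lt_of_le_of_ne (runLen_le K a) ha
    by_cases hs : runLen K (shift a) = K
    · have hpos := runLen_pos (by omega : 0 < K) a
      have h1 : runLen K a = 1 := by
        by_contra h1
        have := runLen_shift (by omega) haK
        omega
      have hl : label K c p a = (Var2.x, Var2.y) := by
        simp [label, ha, hc.eq_one a h1 hs, colourPair]
      rw [hl]
      exact (key _ hs).symm
    · simpa [label, ha, hs] using colourPair_ne (hc.lt _) (hc.lt _) (hc.ne_shift a haK)

lemma dependsOnFirst_label {K M : ℕ} (hK : 0 < K) {c : (ℕ → Fin n) → ℕ} (hc : DependsOnFirst M c)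
    (p : Fin n → Fin n → Var2) : DependsOnFirst (M + 1 + K) (label K c p) := by
  intro a b hab
  have h1 := (dependsOnFirst_runLen hK).mono (by omega : K ≤ M + 1 + K) a b hab
  have h2 := hc.mono (by omega : M ≤ M + 1 + K) a b hab
  simp only [label, h1, h2, hab 0 (by omega), hab K (by omega)]

/-- There are labellings of sequences by pairs of variables that differ under the shift and that
differ in themselves only through `p` and `q`. -/
lemma exists_label (p q : Fin n → Fin n → Var2) (hpq : ∀ i, p i i = Var2.x ∧ q i i = Var2.y) :
    ∃ (K M : ℕ) (c : (ℕ → Fin n) → ℕ), 0 < K ∧ DependsOnFirst M c ∧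
      ∀ a, label K c p a ≠ label K c q (shift a) := by
  -- Going from `4 + n` colours to 4 takes `n` reductions, raising the threshold from 2 to `n + 2`;
  -- the even number `K` must exceed it.
  have hK2 : (2 * (n + 2)) % 2 = 0 := by omega
  have hb := isShiftColouring_baseColour (n := n) (K := 2 * (n + 2)) (by omega) hK2
  have hb' : IsShiftColouring (2 * (n + 2)) (4 + n) 2
      (baseColour (2 * (n + 2)) : (ℕ → Fin n) → ℕ) :=
    { hb with lt := fun a => (hb.lt a).trans_le (by omega) }
  obtain ⟨c, hc⟩ := exists_isShiftColouring_four (by omega) hK2 n 2 le_rfl (by omega) _ hb'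
  obtain ⟨M, hM⟩ := hc.dependsOnFirst
  exact ⟨_, M, c, by omega, hM, label_ne_label_shift hc (by omega) hK2 (by omega) hpq⟩

end Colouring

/-! ### Trees labelled by elements of the algebra -/

section Values

variable {n : ℕ} {A : Type*} {op : (Fin n → A) → A} {z : ℕ → Fin n}

/-- Fix the first `K` letters. If they are all equal to some i, the next level applies `t` to row i
of `p` or `q` and all deeper levels collapse; otherwise the labels involve neither `p` nor `q`. -/
lemma tree_label_fst (hop : ∀ b, op (fun _ => b) = b) {K : ℕ} (hK : 0 < K)
    (c : (ℕ → Fin n) → ℕ) {p q : Fin n → Fin n → Var2} {v : Var2 → A}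
    (h : ∀ i, op (fun j => v (p i j)) = op (fun j => v (q i j))) (M : ℕ) :
    tree op z (M + 1 + K) (fun a => v (label K c p a).1) =
      tree op z (M + 1 + K) (fun a => v (label K c q a).1) := by
  refine tree_congr_prefix (M + 1) K _ _ fun u hu => ?_
  have hrun : ∀ a, runLen K (prefixSeq u a) = runLen K (prefixSeq u z) := fun a =>
    dependsOnFirst_runLen hK _ _ fun s hs => prefixSeq_eq_of_lt u a z (hu ▸ hs)
  by_cases hz : runLen K (prefixSeq u z) = K
  · have hl : ∀ (p : Fin n → Fin n → Var2) (a : ℕ → Fin n),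
        (label K c p (prefixSeq u a)).1 = p (prefixSeq u z 0) (a 0) := by
      intro p a
      have h0 := prefixSeq_eq_of_lt u a z (s := 0) (by omega)
      have hK' : prefixSeq u a K = a 0 := by
        have := prefixSeq_length_add u a 0
        rwa [hu] at this
      simp [label, hrun, hz, h0, hK']
    simp only [hl]
    rw [tree_succ_head hop M fun j => v (p (prefixSeq u z 0) j),
      tree_succ_head hop M fun j => v (q (prefixSeq u z 0) j), h]
  · simp [label, hrun, hz]

lemma tree_label_fst_shift (hop : ∀ b, op (fun _ => b) = b) {K M : ℕ} (hK : 0 < K)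
    {c : (ℕ → Fin n) → ℕ} (hc : DependsOnFirst M c) {p q : Fin n → Fin n → Var2} {v : Var2 → A}
    (h : ∀ i, op (fun j => v (p i j)) = op (fun j => v (q i j))) :
    tree op z (M + 1 + K + 1) (fun a => v (label K c p a).1) =
      tree op z (M + 1 + K + 1) (fun a => v (label K c q (shift a)).1) := by
  rw [tree_succ_shift hop _ fun a => v (label K c q a).1, ← tree_label_fst hop hK c h]
  exact tree_succ_of_dependsOnFirst hop _ _ fun a b hab =>
    congrArg (fun w => v w.1) (dependsOnFirst_label hK hc p a b hab)

lemma tree_label_snd_shift (hop : ∀ b, op (fun _ => b) = b) {K M : ℕ} (hK : 0 < K)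
    {c : (ℕ → Fin n) → ℕ} (hc : DependsOnFirst M c) (p q : Fin n → Fin n → Var2) (v : Var2 → A) :
    tree op z (M + 1 + K + 1) (fun a => v (label K c p a).2) =
      tree op z (M + 1 + K + 1) (fun a => v (label K c q (shift a)).2) := by
  have hpq : ∀ a, (label K c p a).2 = (label K c q a).2 := by
    intro a
    unfold label
    split_ifs <;> rfl
  simp only [← hpq]
  rw [tree_succ_shift hop _ fun a => v (label K c p a).2]
  exact tree_succ_of_dependsOnFirst hop _ _ fun a b hab =>
    congrArg (fun w => v w.2) (dependsOnFirst_label hK hc p a b hab)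

end Values

/-! ### Terms -/

section Terms

variable {L : Language} {A : Type*} [L.Structure A]

lemma realize_const_of_isIdempotentAlgebra (hA : IsIdempotentAlgebra L A) {V : Type*}
    (t : L.Term V) (b : A) : t.realize (fun _ => b) = b := by
  induction t with
  | var _ => rfl
  | func f ts ih => simp [Language.Term.realize, ih, hA _ f b]

lemma realize_tree {n : ℕ} {V : Type*} (t : L.Term (Fin n)) (z : ℕ → Fin n) (k : ℕ)
    (f : (ℕ → Fin n) → L.Term V) (v : V → A) :
    (tree (fun ts => t.subst ts) z k f).realize v =
      tree (fun xs => t.realize xs) z k fun a => (f a).realize v := by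
  induction k generalizing f with
  | zero => rfl
  | succ k ih => simp [tree, ih, Language.Term.realize_subst]

/-- The assignment of a term to the single symbol. -/
def singleAssign {n : ℕ} (d : L.Term (Fin n)) :
    ∀ {m : ℕ}, (singleSignature n).Functions m → L.Term (Fin m)
  | _, SingleSymbol.symb => d

lemma realize_substFunc_symbolApplied {n : ℕ}
    (assign : ∀ {m : ℕ}, (singleSignature n).Functions m → L.Term (Fin m)) (w : Fin n → Var2)
    (v : Var2 → A) :
    ((symbolApplied w).substFunc assign).realize v =
      (assign (m := n) SingleSymbol.symb).realize fun j => v (w j) := by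
  simp [symbolApplied, Language.Term.substFunc, Language.Term.realize_subst]

open Var2 in
/-- The position of the column of the double loop equations with the given entries of the left and
of the right hand sides. -/
def column : Var2 × Var2 → Var2 × Var2 → Fin 12
  | (x, x), (x, y) => 0
  | (x, y), (x, x) => 1
  | (x, x), (y, x) => 2
  | (x, x), (y, y) => 3
  | (x, y), (y, x) => 4
  | (x, y), (y, y) => 5
  | (y, x), (x, x) => 6
  | (y, x), (x, y) => 7
  | (y, y), (x, x) => 8
  | (y, y), (x, y) => 9
  | (y, x), (y, y) => 10
  | (y, y), (y, x) => 11
  -- Only equal pairs reach this default; `exists_label` excludes them at the leaves.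
  | _, _ => 0

open Var2 in
lemma column_spec {c c' : Var2 × Var2} (h : c ≠ c') :
    (![x, x,  x, x, x, x,  y, y, y, y,  y, y] : Fin 12 → Var2) (column c c') = c.1 ∧
    (![x, x,  y, y, y, y,  x, x, x, x,  y, y] : Fin 12 → Var2) (column c c') = c'.1 ∧
    (![x, y,  x, x, y, y,  x, x, y, y,  x, y] : Fin 12 → Var2) (column c c') = c.2 ∧
    (![y, x,  x, y, x, y,  x, y, x, y,  y, x] : Fin 12 → Var2) (column c c') = c'.2 := by
  rcases c with ⟨_ | _, _ | _⟩ <;> rcases c' with ⟨_ | _, _ | _⟩ <;>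
    first | exact absurd rfl h | exact ⟨rfl, rfl, rfl, rfl⟩

lemma satisfiesLocallyOn_doubleLoopEquations {X : Set A} {n : ℕ} (z : ℕ → Fin n)
    (hA : IsIdempotentAlgebra L A) (t : L.Term (Fin n)) (p q : Fin n → Fin n → Var2)
    (hpq : ∀ i, p i i = Var2.x ∧ q i i = Var2.y)
    (ht : ∀ (i : Fin n) (v : Var2 → A), (∀ w, v w ∈ X) →
      t.realize (fun j => v (p i j)) = t.realize (fun j => v (q i j))) :
    SatisfiesLocallyOn L doubleLoopEquations X := by
  obtain ⟨K, M, c, hK, hc, hne⟩ := exists_label p q hpq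
  have hop : ∀ b : A, t.realize (fun _ => b) = b := realize_const_of_isIdempotentAlgebra hA t
  refine ⟨singleAssign (tree (fun ts => t.subst ts) z (M + 1 + K + 1) fun a =>
    Language.Term.var (column (label K c p a) (label K c q (shift a)))), fun e he v hv => ?_⟩
  rcases he with rfl | rfl
  · simpa [realize_substFunc_symbolApplied, singleAssign, realize_tree, column_spec (hne _)] using
      tree_label_fst_shift hop hK hc fun i => ht i v hv
  · simpa [realize_substFunc_symbolApplied, singleAssign, realize_tree, column_spec (hne _)] using
      tree_label_snd_shift hop hK hc p q v

/-- Over `Fin 0` there is no padding sequence `z`, but a nullary term gives a constant `d`. -/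
lemma satisfiesLocallyOn_doubleLoopEquations_of_nullary {X : Set A} (t : L.Term (Fin 0)) :
    SatisfiesLocallyOn L doubleLoopEquations X := by
  refine ⟨singleAssign (t.relabel Fin.elim0), fun e he v _ => ?_⟩
  rcases he with rfl | rfl <;>
  · simp only [realize_substFunc_symbolApplied, singleAssign, Language.Term.realize_relabel]
    exact congrArg t.realize (Subsingleton.elim _ _)

end Terms

end LocalDoubleLoop

theorem mainTheorem4 (L : FirstOrder.Language) [L.IsAlgebraic] (A : Type*) [L.Structure A]
    (hA : LocalDoubleLoop.IsIdempotentAlgebra L A) (X : Set A)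
    (hX : ∃ (n : ℕ)
      (S : LocalDoubleLoop.EquationalCondition (LocalDoubleLoop.singleSignature n)
        LocalDoubleLoop.Var2),
      LocalDoubleLoop.IsTaylorSystem S ∧ LocalDoubleLoop.SatisfiesLocallyOn L S X) :
    LocalDoubleLoop.SatisfiesLocallyOn L LocalDoubleLoop.doubleLoopEquations X := by
  obtain ⟨n, S, ⟨p, q, hpq, rfl⟩, assign, hS⟩ := hX
  rcases n with _ | n
  · exact LocalDoubleLoop.satisfiesLocallyOn_doubleLoopEquations_of_nullary
      (assign (n := 0) LocalDoubleLoop.SingleSymbol.symb)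
  · refine LocalDoubleLoop.satisfiesLocallyOn_doubleLoopEquations (fun _ => 0) hA
      (assign (n := n + 1) LocalDoubleLoop.SingleSymbol.symb) p q hpq fun i v hv => ?_
    have := hS _ (Or.inl ⟨i, rfl⟩) v hv
    rwa [LocalDoubleLoop.realize_substFunc_symbolApplied,
      LocalDoubleLoop.realize_substFunc_symbolApplied] at this
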